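/- Given reals $a\le b$, a continuous t-norm on $[a,b]$ is a continuous map $*\colon[a,b]\times[a,b]\to[a,b]$ such that $([a,b],*,b)$ is a commutative monoid and $p*q\le p'*q'$ whenever $p\le p'$ and $q\le q'$. Two continuous t-norms $([a_1,b_1],*_1)$ and $([a_2,b_2],*_2)$ are isomorphic, written $\cong_t$, if there is an order isomorphism $[a_1,b_1]\to[a_2,b_2]$ that is also an isomorphism of monoids. Let $*_P$ and $*_{Ł}$ be the continuous t-norms on $[0,1]$ given by $p*_Pq=pq$ and $p*_{Ł}q=\max\{0,p+q-1\}$. Let $*$ be a continuous t-norm on $[0,1]$, and call $q\in[0,1]$ idempotent if $q*q=q$. The set of non-idempotent elements of $*$ is open and is the union of its connected components, which are pairwise disjoint open intervals $(c,d)$ with $0\le c<d\le 1$ whose end points are idempotent; for each of them $*$ restricts to a continuous t-norm on $[c,d]$. Let - $\mathcal{I}_P^*$ be the set of those components $(c,d)$ for which $([c,d],*)\cong_t([0,1],*_P)$; - $\mathcal{I}_{Ł}^*$ be the set of those components $(c,d)$ for which $([c,d],*)\cong_t([0,1],*_{Ł})$; - $\mathcal{I}_M^*$ be the set of maximal nonempty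 open intervals $(c,d)\subseteq[0,1]$ all of whose elements are idempotent; and let $\Upsilon([0,1],*)=\mathcal{I}_P^*\cup\mathcal{I}_{Ł}^*\cup\mathcal{I}_M^*$, ordered by $(c,d)\prec(c',d')\iff d\le c'$. **Theorem.** Let $([0,1],*)$ and $([0,1],\bullet)$ be continuous t-norms. Then the following are equivalent: 1. $([0,1],*)\cong_t([0,1],\bullet)$. 2. There is an order isomorphism $\Phi\colon(\Upsilon([0,1],*),\prec)\to(\Upsilon([0,1],\bullet),\prec)$ such that for all $(c,d)\in\Upsilon([0,1],*)$ and all $i\in\{P,Ł,M\}$, $$(c,d)\in\mathcal{I}_i^*\iff\Phi(c,d)\in\mathcal{I}_i^{\bullet}.$$ -/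

import Mathlib

open Set

/-- A continuous t-norm on the real interval `[a, b]`: a continuous binary operation making
`([a, b], *, b)` a commutative monoid, and monotone in both variables. -/
structure ContinuousTNorm (a b : ℝ) where
  le : a ≤ b
  op : Icc a b → Icc a b → Icc a b
  continuous_op : Continuous (fun p : Icc a b × Icc a b => op p.1 p.2)
  op_assoc : ∀ p q r, op (op p q) r = op p (op q r)
  op_comm : ∀ p q, op p q = op q p
  op_unit : ∀ p, op p ⟨b, right_mem_Icc.2 le⟩ = p
  op_mono : ∀ p p' q q', p ≤ p' → q ≤ q' → op p q ≤ op p' q'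

namespace ContinuousTNorm

variable {a b : ℝ}

/-- The unit `b` of a t-norm on `[a, b]`. -/
def unit (T : ContinuousTNorm a b) : Icc a b := ⟨b, right_mem_Icc.2 T.le⟩

/-- `([a₁, b₁], *₁) ≅ₜ ([a₂, b₂], *₂)`: there is an order isomorphism `[a₁, b₁] → [a₂, b₂]` which
is also an isomorphism of monoids. -/
def Isomorphic {a₁ b₁ a₂ b₂ : ℝ} (S : ContinuousTNorm a₁ b₁) (T : ContinuousTNorm a₂ b₂) : Prop :=
  ∃ φ : Icc a₁ b₁ ≃o Icc a₂ b₂, φ S.unit = T.unit ∧ ∀ p q, φ (S.op p q) = T.op (φ p) (φ q)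

/-- `q` is idempotent if `q * q = q`. -/
def Idem (T : ContinuousTNorm a b) (q : Icc a b) : Prop := T.op q q = q

theorem op_le_left (T : ContinuousTNorm a b) (p q : Icc a b) : T.op p q ≤ p := by
  have h := T.op_mono p p q T.unit le_rfl q.2.2
  rwa [show T.op p T.unit = p from T.op_unit p] at h

theorem op_idem_of_le (T : ContinuousTNorm a b) {d x : Icc a b} (hd : T.Idem d) (hx : x ≤ d) :
    T.op x d = x := by
  have hcont : Continuous (fun z : Icc a b => T.op z d) :=
    T.continuous_op.comp (continuous_id.prodMk continuous_const)
  have : Fact (a ≤ b) := ⟨T.le⟩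
  have hbot : T.op ⊥ d ≤ x := (T.op_le_left _ _).trans bot_le
  have htop : x ≤ T.op T.unit d := by
    rw [T.op_comm, show T.op d T.unit = d from T.op_unit d]; exact hx
  obtain ⟨z, hz⟩ := mem_range_of_exists_le_of_exists_ge hcont ⟨_, hbot⟩ ⟨_, htop⟩
  simp only at hz
  rw [← hz, T.op_assoc, show T.op d d = d from hd]

/-- The inclusion `[c, d] → [a, b]`. -/
def incl {c d : Icc a b} (p : Icc (c : ℝ) (d : ℝ)) : Icc a b :=
  ⟨p, c.2.1.trans p.2.1, p.2.2.trans d.2.2⟩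

/-- The restriction of `T` to `[c, d] ⊆ [a, b]`, where `c ≤ d` are idempotent; this is a continuous
t-norm on `[c, d]`. -/
def restrict (T : ContinuousTNorm a b) (c d : Icc a b) (hcd : c ≤ d) (hc : T.Idem c)
    (hd : T.Idem d) : ContinuousTNorm (c : ℝ) (d : ℝ) where
  le := hcd
  op p q := ⟨T.op (incl p) (incl q),
    (congrArg Subtype.val hc).symm.le.trans (T.op_mono c (incl p) c (incl q) p.2.1 q.2.1),
    (T.op_le_left (incl p) (incl q)).trans p.2.2⟩
  continuous_op := by
    have hi : Continuous (incl : Icc (c : ℝ) (d : ℝ) → Icc a b) :=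
      Continuous.subtype_mk continuous_subtype_val _
    exact Continuous.subtype_mk (continuous_subtype_val.comp (T.continuous_op.comp
      ((hi.comp continuous_fst).prodMk (hi.comp continuous_snd)))) _
  op_assoc p q r := by
    apply Subtype.ext
    have h := congrArg Subtype.val (T.op_assoc (incl p) (incl q) (incl r))
    exact h
  op_comm p q := by
    apply Subtype.ext
    have h := congrArg Subtype.val (T.op_comm (incl p) (incl q))
    exact h
  op_unit p := by
    apply Subtype.ext
    have h := congrArg Subtype.val (T.op_idem_of_le (x := incl p) hd p.2.2)
    exact h
  op_mono p p' q q' hp hq := T.op_mono (incl p) (incl p') (incl q) (incl q') hp hq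

/-- The product t-norm on `[0, 1]`. -/
def product : ContinuousTNorm 0 1 where
  le := zero_le_one
  op p q := ⟨(p : ℝ) * q, mul_nonneg p.2.1 q.2.1, mul_le_one₀ p.2.2 q.2.1 q.2.2⟩
  continuous_op := Continuous.subtype_mk (by fun_prop) _
  op_assoc p q r := Subtype.ext (mul_assoc _ _ _)
  op_comm p q := Subtype.ext (mul_comm _ _)
  op_unit p := Subtype.ext (mul_one _)
  op_mono p p' q q' hp hq := mul_le_mul (Subtype.coe_le_coe.2 hp) (Subtype.coe_le_coe.2 hq)
    q.2.1 p'.2.1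

/-- The Łukasiewicz t-norm on `[0, 1]`. -/
def lukasiewicz : ContinuousTNorm 0 1 where
  le := zero_le_one
  op p q := ⟨max 0 ((p : ℝ) + q - 1), le_max_left _ _,
    max_le zero_le_one (by linarith [p.2.2, q.2.2])⟩
  continuous_op := Continuous.subtype_mk (by fun_prop) _
  op_assoc p q r := by
    apply Subtype.ext
    have hp := p.2.2
    have hr := r.2.2
    change max 0 (max 0 ((p : ℝ) + q - 1) + r - 1) = max 0 ((p : ℝ) + max 0 ((q : ℝ) + r - 1) - 1)
    rcases max_cases 0 ((p : ℝ) + q - 1) with h | h <;>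
      rcases max_cases 0 ((q : ℝ) + r - 1) with h' | h' <;>
      rw [h.1, h'.1] <;>
      first
        | (rw [max_eq_left (by linarith), max_eq_left (by linarith)])
        | (congr 1; ring)
  op_comm p q := Subtype.ext (by simp only [add_comm])
  op_unit p := Subtype.ext (by simpa using p.2.1)
  op_mono p p' q q' hp hq := max_le_max le_rfl (by
    have h₁ : (p : ℝ) ≤ p' := hp
    have h₂ : (q : ℝ) ≤ q' := hq
    exact sub_le_sub_right (add_le_add h₁ h₂) 1)

/-- `(c, d)` is one of the pairwise disjoint nonempty open intervals whose union is the set of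
non-idempotent elements of `T`, that is, a connected component of that open set: all its points
are non-idempotent, while its end points are idempotent. -/
structure IsNonIdemInterval (T : ContinuousTNorm a b) (c d : Icc a b) : Prop where
  lt : c < d
  idem_left : T.Idem c
  idem_right : T.Idem d
  not_idem : ∀ q ∈ Ioo c d, ¬ T.Idem q

/-- `(c, d)` is a maximal nonempty open interval of idempotent elements of `T`. -/
structure IsMaxIdemInterval (T : ContinuousTNorm a b) (c d : Icc a b) : Prop where
  lt : c < d
  idem : ∀ q ∈ Ioo c d, T.Idem q
  maximal : ∀ c' d' : Icc a b, c' ≤ c → d ≤ d' → (∀ q ∈ Ioo c' d', T.Idem q) → c' = c ∧ d' = d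

/-- The three types of intervals: product, Łukasiewicz, minimum. -/
inductive IntervalType
  | P
  | L
  | M

/-- The sets of intervals `𝓘_P`, `𝓘_Ł`, `𝓘_M` of a continuous t-norm; the open interval `(c, d)` is
given by the pair of its end points. -/
def intervals (T : ContinuousTNorm a b) : IntervalType → Set (Icc a b × Icc a b)
  | .P => {I | ∃ h : T.IsNonIdemInterval I.1 I.2,
      Isomorphic (T.restrict I.1 I.2 h.lt.le h.idem_left h.idem_right) product}
  | .L => {I | ∃ h : T.IsNonIdemInterval I.1 I.2,
      Isomorphic (T.restrict I.1 I.2 h.lt.le h.idem_left h.idem_right) lukasiewicz}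
  | .M => {I | T.IsMaxIdemInterval I.1 I.2}

/-- The interval system `Υ = 𝓘_P ∪ 𝓘_Ł ∪ 𝓘_M`. -/
def upsilon (T : ContinuousTNorm a b) : Set (Icc a b × Icc a b) :=
  T.intervals .P ∪ T.intervals .L ∪ T.intervals .M

/-- The strict order on the interval system: `(c, d) ≺ (c', d')` iff `d ≤ c'`. -/
def upsilonLT (T : ContinuousTNorm a b) (I J : T.upsilon) : Prop := I.1.2 ≤ J.1.1

end ContinuousTNorm

/-! An isomorphism of t-norms carries idempotents to idempotents and restrictions to isomorphic
restrictions, so it induces `Φ` on end points.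

For the converse, two facts determine a continuous t-norm. If an idempotent lies between `x` and
`y`, their product is `min x y` (`op_eq_left_of_idem`). Otherwise both lie in one non-idempotent
component, where the Mostert–Shields theorem (`exists_strictMono_surjective_of_forall_idem`) leaves
only the product and Łukasiewicz types. Its proof builds a semigroup `t ↦ x ^ t` from iterated
square roots and asks whether it reaches the bottom in finite time.

Given `Φ`, choose an order isomorphism from each interval to its image, multiplicative on the P and
Ł intervals. The intervals may miss many idempotents, for instance points of a Cantor set, but their
union is dense (`exists_mem_upsilon`), so the pieces extend by completeness to one order isomorphism
(`exists_orderIso_of_dense_relation`), which is then checked to be multiplicative. -/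

set_option linter.unusedSectionVars false

/-! ### One-parameter semigroups and the Mostert–Shields theorem -/

section FlowTheory

open Filter Topology

theorem root_sequence_pow {M : Type*} [CommMonoid M] {u : ℕ → M}
    (hu : ∀ n, u (n + 1) * u (n + 1) = u n) (m k : ℕ) :
    u (m + k) ^ (2 ^ k) = u m := by
  induction k with
  | zero => simp
  | succ k ih => rw [pow_succ', pow_mul, pow_two, ← add_assoc, hu, ih]

variable {X : Type*} [CompleteLinearOrder X] [CommMonoid X] [IsOrderedMonoid X]

theorem mul_le_left_of_one_eq_top (h1 : (1 : X) = ⊤) (x y : X) : x * y ≤ x := by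
  calc x * y ≤ x * 1 := mul_le_mul_right (h1 ▸ le_top) x
    _ = x := mul_one x

theorem bot_mul_of_one_eq_top (h1 : (1 : X) = ⊤) (x : X) : ⊥ * x = ⊥ :=
  le_bot_iff.1 (mul_le_left_of_one_eq_top h1 ⊥ x)

theorem pow_antitone_of_one_eq_top (h1 : (1 : X) = ⊤) (x : X) : Antitone (fun n : ℕ => x ^ n) :=
  antitone_nat_of_succ_le fun n => by
    rw [pow_succ]; exact mul_le_left_of_one_eq_top h1 _ _

variable [TopologicalSpace X] [OrderTopology X] [ContinuousMul X]

/-- The powers decrease, and by continuity their limit is idempotent; being below `x ≠ ⊤`, it is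
`⊥`. -/
theorem tendsto_pow_bot (h1 : (1 : X) = ⊤) (hid : ∀ q : X, q * q = q → q = ⊥ ∨ q = ⊤) {x : X}
    (hx : x ≠ ⊤) : Tendsto (fun n : ℕ => x ^ n) atTop (𝓝 ⊥) := by
  have hanti := pow_antitone_of_one_eq_top h1 x
  have hlim := tendsto_atTop_iInf hanti
  set l := ⨅ n : ℕ, x ^ n
  have hsq : l * l = l := by
    refine tendsto_nhds_unique (hlim.mul hlim) ?_
    have h2 : Tendsto (fun n : ℕ => n + n) atTop atTop :=
      tendsto_atTop_mono (fun n => Nat.le_add_left n n) tendsto_id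
    refine (hlim.comp h2).congr fun n => ?_
    exact pow_add x n n
  have hlx : l ≤ x := (iInf_le _ 1).trans (pow_one x).le
  rcases hid l hsq with h | h
  · rwa [h] at hlim
  · exact absurd (top_le_iff.1 (h ▸ hlx)) hx

/-- Intermediate value theorem for `w ↦ z * w`, which runs from `⊥` to `z`. -/
theorem exists_mul_eq_of_le [DenselyOrdered X] (h1 : (1 : X) = ⊤) {y z : X} (hyz : y ≤ z) :
    ∃ w, z * w = y := by
  have hc : Continuous (fun w : X => z * w) := continuous_const.mul continuous_id
  refine mem_range_of_exists_le_of_exists_ge hc ⟨⊥, ?_⟩ ⟨1, by simpa using hyz⟩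
  rw [mul_comm, bot_mul_of_one_eq_top h1]; exact bot_le

theorem exists_mul_self_eq [DenselyOrdered X] (h1 : (1 : X) = ⊤) (x : X) : ∃ r, r * r = x := by
  have hc : Continuous (fun w : X => w * w) := continuous_id.mul continuous_id
  refine mem_range_of_exists_le_of_exists_ge hc ⟨⊥, ?_⟩ ⟨1, ?_⟩
  · rw [bot_mul_of_one_eq_top h1]; exact bot_le
  · rw [mul_one, h1]; exact le_top

/-- Writing `y = z * w` gives `x * z = x * z * w ^ n` for all `n`; unless `w = ⊤`, the right side
tends to `⊥`. -/
theorem eq_of_mul_eq_mul_of_ne_bot [DenselyOrdered X] (h1 : (1 : X) = ⊤)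
    (hid : ∀ q : X, q * q = q → q = ⊥ ∨ q = ⊤) {x y z : X} (hyz : y ≤ z) (h : x * y = x * z)
    (hne : x * z ≠ ⊥) : y = z := by
  obtain ⟨w, rfl⟩ := exists_mul_eq_of_le h1 hyz
  by_cases hw : w = ⊤
  · rw [hw, ← h1, mul_one]
  exfalso
  apply hne
  have hpow : ∀ n : ℕ, x * z * w ^ n = x * z := fun n => by
    induction n with
    | zero => simp
    | succ n ih => rw [pow_succ, ← mul_assoc, ih, mul_assoc, h]
  have hl : Tendsto (fun n : ℕ => x * z * w ^ n) atTop (𝓝 (x * z * ⊥)) :=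
    tendsto_const_nhds.mul (tendsto_pow_bot h1 hid hw)
  rw [mul_comm _ (⊥ : X), bot_mul_of_one_eq_top h1] at hl
  exact tendsto_nhds_unique (tendsto_const_nhds.congr fun n => (hpow n).symm) hl

/-- Iterated square roots increase to an idempotent above `x ≠ ⊥`, which must be `⊤`. -/
theorem exists_root_sequence [DenselyOrdered X] (h1 : (1 : X) = ⊤)
    (hid : ∀ q : X, q * q = q → q = ⊥ ∨ q = ⊤) {x : X} (hx : x ≠ ⊥) :
    ∃ u : ℕ → X, u 0 = x ∧ (∀ n, u (n + 1) * u (n + 1) = u n) ∧ Tendsto u atTop (𝓝 ⊤) := by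
  choose r hr using exists_mul_self_eq (X := X) h1
  let u : ℕ → X := fun n => r^[n] x
  have hu : ∀ n, u (n + 1) * u (n + 1) = u n := fun n => by
    simp only [u, Function.iterate_succ_apply', hr]
  refine ⟨u, rfl, hu, ?_⟩
  have hmono : Monotone u := monotone_nat_of_le_succ fun n => by
    rw [← hu n]; exact mul_le_left_of_one_eq_top h1 _ _
  have hlim := tendsto_atTop_iSup hmono
  have hsq : (⨆ n, u n) * (⨆ n, u n) = ⨆ n, u n := by
    refine tendsto_nhds_unique ?_ hlim
    have h := hlim.comp (tendsto_add_atTop_nat 1)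
    exact (h.mul h).congr hu
  rcases hid _ hsq with h | h
  · exact absurd (le_bot_iff.1 (h ▸ le_iSup u 0)) hx
  · rwa [h] at hlim

/-- A one-parameter semigroup running from the top element to the bottom element. -/
structure IsFlow (g : ℝ → X) : Prop where
  add : ∀ s t, 0 ≤ s → 0 ≤ t → g (s + t) = g s * g t
  top : Tendsto (fun n : ℕ => g (1 / 2 ^ n)) atTop (𝓝 ⊤)
  bot : Tendsto (fun n : ℕ => g n) atTop (𝓝 ⊥)

theorem exists_isFlow [DenselyOrdered X] [Nontrivial X] (h1 : (1 : X) = ⊤)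
    (hid : ∀ q : X, q * q = q → q = ⊥ ∨ q = ⊤) : ∃ g : ℝ → X, IsFlow g := by
  obtain ⟨x, hx0, hx1⟩ := exists_between (bot_lt_top (α := X))
  obtain ⟨u, hu0, hu, hutop⟩ := exists_root_sequence h1 hid hx0.ne'
  -- Since `u n` plays the role of `x ^ (1 / 2 ^ n)`, `G t n` approximates `x ^ t` from above,
  -- decreasing in `n`.
  let G : ℝ → ℕ → X := fun t n => u n ^ ⌊2 ^ n * t⌋₊
  have hG : ∀ t, Antitone (G t) := fun t => antitone_nat_of_succ_le fun n => by
    simp only [G]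
    rw [← hu n, ← pow_two, ← pow_mul]
    apply pow_antitone_of_one_eq_top h1
    rcases le_total 0 t with ht | ht
    · apply Nat.le_floor
      push_cast
      rw [pow_succ']
      have := Nat.floor_le (a := 2 ^ n * t) (by positivity)
      linarith
    · rw [Nat.floor_of_nonpos (a := 2 ^ n * t)]
      · simp
      · exact mul_nonpos_of_nonneg_of_nonpos (by positivity) ht
  have hlim : ∀ t, Tendsto (G t) atTop (𝓝 (⨅ n, G t n)) := fun t => tendsto_atTop_iInf (hG t)
  refine ⟨fun t => ⨅ n, G t n, ?_, ?_, ?_⟩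
  · intro s t hs ht
    refine tendsto_nhds_unique (hlim (s + t)) ?_
    have hup : Tendsto (fun n => G s n * G t n) atTop (𝓝 ((⨅ n, G s n) * ⨅ n, G t n)) :=
      (hlim s).mul (hlim t)
    have hlow := hup.mul hutop
    rw [← h1, mul_one] at hlow
    -- The floor of a sum exceeds the sum of the floors by at most one; the extra factor `u n` tends
    -- to `1`.
    refine tendsto_of_tendsto_of_tendsto_of_le_of_le hlow hup (fun n => ?_) (fun n => ?_)
    · simp only [G]
      rw [← pow_add, ← pow_succ]
      apply pow_antitone_of_one_eq_top h1
      rw [← Nat.lt_succ_iff, Nat.floor_lt (by positivity)]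
      push_cast
      have := Nat.lt_floor_add_one (2 ^ n * s)
      have := Nat.lt_floor_add_one (2 ^ n * t)
      linarith
    · simp only [G]
      rw [← pow_add]
      apply pow_antitone_of_one_eq_top h1
      apply Nat.le_floor
      push_cast
      have := Nat.floor_le (a := 2 ^ n * s) (by positivity)
      have := Nat.floor_le (a := 2 ^ n * t) (by positivity)
      linarith
  · refine tendsto_of_tendsto_of_tendsto_of_le_of_le hutop tendsto_const_nhds (fun m => ?_)
      (fun m => le_top)
    refine le_iInf fun n => ?_
    simp only [G]
    rcases le_or_gt m n with h | h
    · obtain ⟨k, rfl⟩ := Nat.exists_eq_add_of_le h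
      have : (2 : ℝ) ^ (m + k) * (1 / 2 ^ m) = ((2 ^ k : ℕ) : ℝ) := by
        push_cast; rw [pow_add]; field_simp
      rw [this, Nat.floor_natCast, root_sequence_pow hu]
    · have : ⌊(2 : ℝ) ^ n * (1 / 2 ^ m)⌋₊ = 0 := by
        rw [Nat.floor_eq_zero, mul_one_div, div_lt_one (by positivity)]
        exact pow_lt_pow_right₀ (by norm_num) h
      rw [this, pow_zero, h1]
      exact le_top
  · refine tendsto_of_tendsto_of_tendsto_of_le_of_le tendsto_const_nhds
      (tendsto_pow_bot h1 hid hx1.ne) (fun m => bot_le) (fun m => (iInf_le _ 0).trans ?_)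
    simp [G, hu0]

namespace IsFlow

variable {g : ℝ → X}

theorem le_of_le (hg : IsFlow g) (h1 : (1 : X) = ⊤) {s t : ℝ} (hs : 0 ≤ s) (hst : s ≤ t) :
    g t ≤ g s := by
  have h := hg.add s (t - s) hs (sub_nonneg.2 hst)
  rw [add_sub_cancel] at h
  rw [h]
  exact mul_le_left_of_one_eq_top h1 _ _

theorem zero (hg : IsFlow g) (h1 : (1 : X) = ⊤) : g 0 = ⊤ :=
  top_le_iff.1 (le_of_tendsto' hg.top fun n => hg.le_of_le h1 le_rfl (by positivity))

theorem tendsto_right (hg : IsFlow g) (h1 : (1 : X) = ⊤) {t : ℝ} (ht : 0 ≤ t) :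
    Tendsto (fun n : ℕ => g (t + 1 / 2 ^ n)) atTop (𝓝 (g t)) := by
  have h : Tendsto (fun n : ℕ => g t * g (1 / 2 ^ n)) atTop (𝓝 (g t * ⊤)) :=
    tendsto_const_nhds.mul hg.top
  rw [← h1, mul_one] at h
  exact h.congr fun n => (hg.add _ _ ht (by positivity)).symm

/-- The time is the last one at which `g` is still at least `x`. Right continuity gives `g t ≤ x`;
the semigroup law, applied to earlier times within `1 / 2 ^ n`, gives `x ≤ g t`. -/
theorem exists_eq (hg : IsFlow g) (h1 : (1 : X) = ⊤) {x : X} (hx : x ≠ ⊥) :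
    ∃ t, 0 ≤ t ∧ g t = x := by
  let A : Set ℝ := {t | 0 ≤ t ∧ x ≤ g t}
  have hA0 : (0 : ℝ) ∈ A := ⟨le_rfl, by rw [hg.zero h1]; exact le_top⟩
  obtain ⟨N, hN⟩ := (hg.bot.eventually (gt_mem_nhds (bot_lt_iff_ne_bot.2 hx))).exists
  have hbdd : BddAbove A := ⟨N, fun t ht => by
    by_contra! h
    exact absurd (ht.2.trans (hg.le_of_le h1 (Nat.cast_nonneg N) h.le)) (not_le.2 hN)⟩
  have ht0 : 0 ≤ sSup A := le_csSup hbdd hA0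
  refine ⟨sSup A, ht0, le_antisymm ?_ ?_⟩
  · refine le_of_tendsto' (hg.tendsto_right h1 ht0) fun n => ?_
    by_contra! h
    have hpos : (0 : ℝ) < 1 / 2 ^ n := by positivity
    have := le_csSup hbdd (show sSup A + 1 / 2 ^ n ∈ A from ⟨by positivity, h.le⟩)
    linarith
  · have hl : Tendsto (fun n : ℕ => x * g (1 / 2 ^ n)) atTop (𝓝 (x * ⊤)) :=
      tendsto_const_nhds.mul hg.top
    rw [← h1, mul_one] at hl
    refine le_of_tendsto' hl fun n => ?_
    have hpos : (0 : ℝ) < 1 / 2 ^ n := by positivity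
    obtain ⟨s, hs, hlt⟩ := exists_lt_of_lt_csSup ⟨0, hA0⟩ (sub_lt_self (sSup A) hpos)
    have hle : s ≤ sSup A := le_csSup hbdd hs
    have h := hg.add s (sSup A - s) hs.1 (sub_nonneg.2 hle)
    rw [add_sub_cancel] at h
    rw [h]
    exact mul_le_mul' hs.2 (hg.le_of_le h1 (sub_nonneg.2 hle) (by linarith))

/-- If `g t = g s`, cancellation forces `g (t - s) = 1`, so `g` is `⊤` at all multiples of `t - s`
and cannot tend to `⊥`. -/
theorem lt_of_lt [DenselyOrdered X] [Nontrivial X] (hg : IsFlow g) (h1 : (1 : X) = ⊤)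
    (hid : ∀ q : X, q * q = q → q = ⊥ ∨ q = ⊤) {s t : ℝ} (hs : 0 ≤ s) (hst : s < t)
    (hne : g s ≠ ⊥) : g t < g s := by
  refine lt_of_le_of_ne (hg.le_of_le h1 hs hst.le) fun heq => ?_
  have h := hg.add s (t - s) hs (sub_nonneg.2 hst.le)
  rw [add_sub_cancel, heq] at h
  have htop : g (t - s) = 1 := by
    refine eq_of_mul_eq_mul_of_ne_bot h1 hid (x := g s) (h1 ▸ le_top) ?_ (by rwa [mul_one])
    rw [← h, mul_one]
  have hall : ∀ n : ℕ, g (n * (t - s)) = ⊤ := fun n => by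
    induction n with
    | zero => simpa using hg.zero h1
    | succ n ih =>
      have hn : (0 : ℝ) ≤ n * (t - s) := mul_nonneg (Nat.cast_nonneg n) (sub_nonneg.2 hst.le)
      rw [Nat.cast_succ, add_mul, one_mul, hg.add _ _ hn (sub_nonneg.2 hst.le), ih, htop, mul_one]
  have : (⊤ : X) ≤ ⊥ := ge_of_tendsto' hg.bot fun m => by
    obtain ⟨n, hn⟩ := exists_nat_ge ((m : ℝ) / (t - s))
    rw [← hall n]
    exact hg.le_of_le h1 (Nat.cast_nonneg m) ((div_le_iff₀ (sub_pos.2 hst)).1 hn)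
  exact absurd (le_bot_iff.1 this) top_ne_bot

end IsFlow

open ContinuousTNorm in
/-- The Mostert–Shields theorem for monoids without nontrivial idempotents. -/
theorem exists_strictMono_surjective_of_forall_idem [DenselyOrdered X] [Nontrivial X]
    (h1 : (1 : X) = ⊤) (hid : ∀ q : X, q * q = q → q = ⊥ ∨ q = ⊤) :
    ∃ ψ : Icc (0 : ℝ) 1 → X, StrictMono ψ ∧ Function.Surjective ψ ∧
      ((∀ p q, ψ (product.op p q) = ψ p * ψ q) ∨
        ∀ p q, ψ (lukasiewicz.op p q) = ψ p * ψ q) := by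
  obtain ⟨g, hg⟩ := exists_isFlow h1 hid
  -- A flow that never reaches `⊥` gives the product; one that does gives Łukasiewicz.
  by_cases hne : ∀ t, 0 ≤ t → g t ≠ ⊥
  · have hlog : ∀ p : Icc (0 : ℝ) 1, 0 ≤ -Real.log p := fun p =>
      neg_nonneg.2 (Real.log_nonpos p.2.1 p.2.2)
    -- The point `0` needs its own clause: `Real.log 0 = 0` would send it to `g 0 = ⊤`.
    refine ⟨fun p => if (p : ℝ) = 0 then ⊥ else g (-Real.log p), ?_, ?_, Or.inl ?_⟩
    · intro p q hpq
      have hpq' : (p : ℝ) < q := hpq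
      have hq : (q : ℝ) ≠ 0 := (p.2.1.trans_lt hpq').ne'
      simp only [if_neg hq]
      split_ifs with hp
      · exact bot_lt_iff_ne_bot.2 (hne _ (hlog q))
      · refine hg.lt_of_lt h1 hid (hlog q) ?_ (hne _ (hlog q))
        exact neg_lt_neg (Real.log_lt_log (lt_of_le_of_ne p.2.1 (Ne.symm hp)) hpq')
    · intro x
      by_cases hx : x = ⊥
      · exact ⟨⟨0, by simp⟩, by simp [hx]⟩
      obtain ⟨t, ht, rfl⟩ := hg.exists_eq h1 hx
      refine ⟨⟨Real.exp (-t), (Real.exp_pos _).le, Real.exp_le_one_iff.2 (by linarith)⟩, ?_⟩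
      simp [Real.exp_ne_zero]
    · intro p q
      change (if (p : ℝ) * q = 0 then ⊥ else g (-Real.log ((p : ℝ) * q))) = _
      by_cases hp : (p : ℝ) = 0
      · simp [hp, bot_mul_of_one_eq_top h1]
      by_cases hq : (q : ℝ) = 0
      · simp [hq, mul_comm _ (⊥ : X), bot_mul_of_one_eq_top h1]
      simp only [mul_eq_zero, hp, hq, or_self, if_false]
      rw [Real.log_mul hp hq, neg_add, hg.add _ _ (hlog p) (hlog q)]
  · push Not at hne
    let A : Set ℝ := {t | 0 ≤ t ∧ g t = ⊥}
    have hA : A.Nonempty := hne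
    have hbdd : BddBelow A := ⟨0, fun t ht => ht.1⟩
    -- The first time at which the flow is `⊥`; rescaling `[0, c]` to the unit interval turns
    -- truncated addition into the Łukasiewicz operation.
    obtain ⟨c, hc⟩ : ∃ c, c = sInf A := ⟨_, rfl⟩
    have hc0 : 0 ≤ c := hc ▸ le_csInf hA fun t ht => ht.1
    have hgc : g c = ⊥ := by
      refine le_bot_iff.1 (le_of_tendsto' (hg.tendsto_right h1 hc0) fun n => ?_)
      obtain ⟨s, hs, hlt⟩ := exists_lt_of_csInf_lt hA
        (show sInf A < c + 1 / 2 ^ n by rw [← hc]; exact lt_add_of_pos_right _ (by positivity))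
      exact (hg.le_of_le h1 hs.1 hlt.le).trans hs.2.le
    have hcpos : 0 < c := lt_of_le_of_ne hc0 fun h => by
      rw [← h, hg.zero h1] at hgc
      exact top_ne_bot hgc
    have hlt : ∀ t, 0 ≤ t → t < c → g t ≠ ⊥ := fun t h0 h h' =>
      absurd (hc ▸ csInf_le hbdd ⟨h0, h'⟩) (not_le.2 h)
    have harg : ∀ p : Icc (0 : ℝ) 1, 0 ≤ c * (1 - p) := fun p =>
      mul_nonneg hc0 (sub_nonneg.2 p.2.2)
    refine ⟨fun p => g (c * (1 - p)), ?_, ?_, Or.inr ?_⟩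
    · intro p q hpq
      have hpq' : (p : ℝ) < q := hpq
      have hp := p.2.1
      exact hg.lt_of_lt h1 hid (harg q) (by nlinarith) (hlt _ (harg q) (by nlinarith))
    · intro x
      by_cases hx : x = ⊥
      · exact ⟨⟨0, by simp⟩, by simp [hx, hgc]⟩
      obtain ⟨t, ht, rfl⟩ := hg.exists_eq h1 hx
      have htc : t < c := by
        by_contra! h
        exact hx (le_bot_iff.1 ((hg.le_of_le h1 hc0 h).trans hgc.le))
      refine ⟨⟨1 - t / c, sub_nonneg.2 ((div_le_one hcpos).2 htc.le),
        sub_le_self _ (by positivity)⟩, ?_⟩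
      simp only [sub_sub_cancel]
      rw [mul_div_cancel₀ _ hcpos.ne']
    · intro p q
      change g (c * (1 - max 0 ((p : ℝ) + q - 1))) = _
      rw [← hg.add _ _ (harg p) (harg q)]
      rcases max_cases 0 ((p : ℝ) + q - 1) with h | h <;> rw [h.1]
      · rw [sub_zero, mul_one, hgc, eq_comm, ← le_bot_iff, ← hgc]
        exact hg.le_of_le h1 hc0 (by nlinarith)
      · congr 1
        ring

end FlowTheory

/-! ### Constructing order isomorphisms -/

/-- A strictly monotone relation between complete linear orders with dense domain and dense range
extends to an order isomorphism. -/
theorem exists_orderIso_of_dense_relation {X Y : Type*} [CompleteLinearOrder X]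
    [DenselyOrdered X] [CompleteLinearOrder Y] [DenselyOrdered Y] (R : X → Y → Prop)
    (hR : ∀ x y x' y', R x y → R x' y' → (x < x' ↔ y < y'))
    (hX : ∀ x x', x < x' → ∃ z w, x < z ∧ z < x' ∧ R z w)
    (hY : ∀ y y', y < y' → ∃ z w, y < w ∧ w < y' ∧ R z w) :
    ∃ φ : X ≃o Y, ∀ x y, R x y → φ x = y := by
  have hRle : ∀ x y x' y', R x y → R x' y' → (x ≤ x' ↔ y ≤ y') := fun x y x' y' h h' => by
    rw [← not_lt, ← not_lt, hR _ _ _ _ h' h]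
  let φ : X → Y := fun x => sSup {y | ∃ x' ≤ x, R x' y}
  have hφ : ∀ x y, R x y → φ x = y := fun x y h => by
    refine le_antisymm (sSup_le ?_) (le_sSup ⟨x, le_rfl, h⟩)
    rintro y' ⟨x', hx', h'⟩
    exact (hRle _ _ _ _ h' h).1 hx'
  have hmono : Monotone φ := fun x x' hxx' =>
    sSup_le_sSup fun y ⟨z, hz, h⟩ => ⟨z, hz.trans hxx', h⟩
  have hstrict : StrictMono φ := fun x x' hxx' => by
    -- Two intermediate points are needed, since `R` gives strict inequality only between related
    -- points.
    obtain ⟨z, w, hxz, hzx, h⟩ := hX x x' hxx'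
    obtain ⟨z', w', hzz', hz'x, h'⟩ := hX z x' hzx
    calc φ x ≤ φ z := hmono hxz.le
      _ = w := hφ _ _ h
      _ < w' := (hR _ _ _ _ h h').1 hzz'
      _ = φ z' := (hφ _ _ h').symm
      _ ≤ φ x' := hmono hz'x.le
  have hsurj : Function.Surjective φ := fun y => by
    refine ⟨sSup {x | ∃ y' ≤ y, R x y'}, le_antisymm ?_ ?_⟩
    · by_contra! hlt
      obtain ⟨z, w, hyw, hw, h⟩ := hY _ _ hlt
      rw [← hφ _ _ h, hstrict.lt_iff_lt] at hw
      obtain ⟨x', ⟨y', hy', h'⟩, hzx⟩ := lt_sSup_iff.1 hw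
      exact absurd ((hR _ _ _ _ h h').1 hzx) (not_lt.2 (hy'.trans hyw.le))
    · by_contra! hlt
      obtain ⟨z, w, hw, hwy, h⟩ := hY _ _ hlt
      rw [← hφ _ _ h, hstrict.lt_iff_lt] at hw
      exact absurd (le_sSup (show z ∈ {x | ∃ y' ≤ y, R x y'} from ⟨w, hwy.le, h⟩)) (not_le.2 hw)
  exact ⟨hstrict.orderIsoOfSurjective φ hsurj, hφ⟩

theorem exists_orderIso_Icc {a b c d : ℝ} (hab : a < b) (hcd : c < d) :
    Nonempty (Icc a b ≃o Icc c d) := by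
  have hb : 0 < b - a := sub_pos.2 hab
  have hd : 0 < d - c := sub_pos.2 hcd
  let f : Icc a b → Icc c d := fun x => ⟨c + (x - a) / (b - a) * (d - c), by
    have h1 : 0 ≤ (x - a) / (b - a) := div_nonneg (sub_nonneg.2 x.2.1) hb.le
    have h2 : (x - a) / (b - a) ≤ 1 := (div_le_one hb).2 (by linarith [x.2.2])
    constructor <;> nlinarith⟩
  have hf : StrictMono f := fun x y hxy => by
    have hxy' : (x : ℝ) < y := hxy
    change c + (x - a) / (b - a) * (d - c) < c + (y - a) / (b - a) * (d - c)
    gcongr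
  have hs : Function.Surjective f := fun y => by
    have h1 : 0 ≤ (y - c) / (d - c) := div_nonneg (sub_nonneg.2 y.2.1) hd.le
    have h2 : (y - c) / (d - c) ≤ 1 := (div_le_one hd).2 (by linarith [y.2.2])
    refine ⟨⟨a + (y - c) / (d - c) * (b - a), by constructor <;> nlinarith⟩, Subtype.ext ?_⟩
    simp only [f]
    field_simp
    ring
  exact ⟨hf.orderIsoOfSurjective f hs⟩

/-! ### Isomorphisms, idempotents and the interval system -/

namespace ContinuousTNorm

variable {a b a' b' a'' b'' : ℝ}

/-- The unit is the top element, so every order isomorphism preserves it. -/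
theorem isomorphic_of_orderIso {S : ContinuousTNorm a b} {T : ContinuousTNorm a' b'}
    (φ : Icc a b ≃o Icc a' b') (h : ∀ p q, φ (S.op p q) = T.op (φ p) (φ q)) :
    Isomorphic S T := by
  refine ⟨φ, le_antisymm (φ S.unit).2.2 ?_, h⟩
  rw [← φ.symm_apply_le]
  exact (φ.symm T.unit).2.2

theorem symm_op {S : ContinuousTNorm a b} {T : ContinuousTNorm a' b'}
    {φ : Icc a b ≃o Icc a' b'} (h : ∀ p q, φ (S.op p q) = T.op (φ p) (φ q)) (p q : Icc a' b') :
    φ.symm (T.op p q) = S.op (φ.symm p) (φ.symm q) := by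
  rw [φ.symm_apply_eq, h, φ.apply_symm_apply, φ.apply_symm_apply]

theorem Isomorphic.symm {S : ContinuousTNorm a b} {T : ContinuousTNorm a' b'}
    (h : Isomorphic S T) : Isomorphic T S := by
  obtain ⟨φ, -, hφ⟩ := h
  exact isomorphic_of_orderIso φ.symm (symm_op hφ)

theorem Isomorphic.trans {S : ContinuousTNorm a b} {T : ContinuousTNorm a' b'}
    {U : ContinuousTNorm a'' b''} (h : Isomorphic S T) (h' : Isomorphic T U) :
    Isomorphic S U := by
  obtain ⟨φ, -, hφ⟩ := h
  obtain ⟨φ', -, hφ'⟩ := h'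
  exact isomorphic_of_orderIso (φ.trans φ') fun p q => by
    simp only [OrderIso.trans_apply, hφ, hφ']

/-- A continuous t-norm without nontrivial idempotents is isomorphic to the product or the
Łukasiewicz t-norm. -/
theorem isomorphic_product_or_lukasiewicz (T : ContinuousTNorm a b) (hab : a < b)
    (hid : ∀ q : Icc a b, T.Idem q → (q : ℝ) = a ∨ (q : ℝ) = b) :
    Isomorphic T product ∨ Isomorphic T lukasiewicz := by
  have : Fact (a ≤ b) := ⟨T.le⟩
  let _ : CommMonoid (Icc a b) :=
    { mul := T.op
      mul_assoc := T.op_assoc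
      mul_comm := T.op_comm
      one := T.unit
      one_mul := fun p => (T.op_comm _ _).trans (T.op_unit p)
      mul_one := T.op_unit }
  have : ContinuousMul (Icc a b) := ⟨T.continuous_op⟩
  have : IsOrderedMonoid (Icc a b) :=
    { mul_le_mul_left := fun p q h r => T.op_mono p q r r h le_rfl }
  have : Nontrivial (Icc a b) :=
    ⟨⟨a, left_mem_Icc.2 T.le⟩, ⟨b, right_mem_Icc.2 T.le⟩, fun h => hab.ne (congrArg Subtype.val h)⟩
  obtain ⟨ψ, hmono, hsurj, h⟩ := exists_strictMono_surjective_of_forall_idem (X := Icc a b) rfl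
    fun q hq => (hid q hq).imp (fun h => Subtype.ext h) (fun h => Subtype.ext h)
  exact h.imp
    (fun h => (isomorphic_of_orderIso (hmono.orderIsoOfSurjective ψ hsurj) h).symm)
    (fun h => (isomorphic_of_orderIso (hmono.orderIsoOfSurjective ψ hsurj) h).symm)

theorem op_eq_left_of_idem (T : ContinuousTNorm a b) {x e y : Icc a b} (he : T.Idem e)
    (hx : x ≤ e) (hy : e ≤ y) : T.op x y = x := by
  refine le_antisymm (T.op_le_left x y) ?_
  calc x = T.op x e := (T.op_idem_of_le he hx).symm
    _ ≤ T.op x y := T.op_mono _ _ _ _ le_rfl hy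

theorem isClosed_idem (T : ContinuousTNorm a b) : IsClosed {q | T.Idem q} :=
  isClosed_eq (T.continuous_op.comp (continuous_id.prodMk continuous_id)) continuous_id

theorem idem_unit (T : ContinuousTNorm a b) : T.Idem T.unit := T.op_unit _

theorem idem_left_end (T : ContinuousTNorm a b) : T.Idem ⟨a, left_mem_Icc.2 T.le⟩ :=
  le_antisymm (T.op_le_left _ _) (T.op ⟨a, left_mem_Icc.2 T.le⟩ ⟨a, left_mem_Icc.2 T.le⟩).2.1

/-- The end points are the nearest idempotents on either side of `q`; they exist because the
idempotents form a closed set containing both ends of `[a, b]`. -/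
theorem exists_isNonIdemInterval (T : ContinuousTNorm a b) {q : Icc a b} (hq : ¬ T.Idem q) :
    ∃ c d, T.IsNonIdemInterval c d ∧ q ∈ Ioo c d := by
  have : Fact (a ≤ b) := ⟨T.le⟩
  let A : Set (Icc a b) := {e | T.Idem e} ∩ Iic q
  let B : Set (Icc a b) := {e | T.Idem e} ∩ Ici q
  have hA : sSup A ∈ A :=
    (T.isClosed_idem.inter isClosed_Iic).sSup_mem ⟨_, T.idem_left_end, q.2.1⟩
  have hB : sInf B ∈ B :=
    (T.isClosed_idem.inter isClosed_Ici).sInf_mem ⟨_, T.idem_unit, q.2.2⟩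
  have hAq : sSup A < q := lt_of_le_of_ne hA.2 fun h => hq (h ▸ hA.1)
  have hBq : q < sInf B := lt_of_le_of_ne hB.2 fun h => hq (h ▸ hB.1)
  refine ⟨sSup A, sInf B, ⟨hAq.trans hBq, hA.1, hB.1, fun r hr hri => ?_⟩, hAq, hBq⟩
  rcases le_total r q with h | h
  · exact not_le.2 hr.1 (le_sSup ⟨hri, h⟩)
  · exact not_le.2 hr.2 (sInf_le ⟨hri, h⟩)

theorem exists_isMaxIdemInterval (T : ContinuousTNorm a b) {x y : Icc a b} (hxy : x < y)
    (h : ∀ q ∈ Ioo x y, T.Idem q) : ∃ c d, T.IsMaxIdemInterval c d ∧ c ≤ x ∧ y ≤ d := by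
  have : Fact (a ≤ b) := ⟨T.le⟩
  obtain ⟨z, hxz, hzy⟩ := exists_between hxy
  -- Anchoring at `z` lets the interval be enlarged to the left and to the right independently.
  let A : Set (Icc a b) := {c | ∀ q, c < q → q ≤ z → T.Idem q}
  let B : Set (Icc a b) := {d | ∀ q, z ≤ q → q < d → T.Idem q}
  have hA : x ∈ A := fun q h1 h2 => h q ⟨h1, h2.trans_lt hzy⟩
  have hB : y ∈ B := fun q h1 h2 => h q ⟨hxz.trans_le h1, h2⟩
  have hAx : sInf A ≤ x := sInf_le hA
  have hBy : y ≤ sSup B := le_sSup hB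
  refine ⟨sInf A, sSup B, ⟨hAx.trans_lt (hxy.trans_le hBy), fun q hq => ?_, ?_⟩, hAx, hBy⟩
  · rcases le_total q z with hqz | hqz
    · obtain ⟨c, hc, hcq⟩ := sInf_lt_iff.1 hq.1
      exact hc q hcq hqz
    · obtain ⟨d, hd, hqd⟩ := lt_sSup_iff.1 hq.2
      exact hd q hqz hqd
  · intro c' d' hc hd hcd
    have hzd : z < d' := hzy.trans_le (hBy.trans hd)
    have hcz : c' < z := (hc.trans hAx).trans_lt hxz
    exact ⟨le_antisymm hc (sInf_le fun q h1 h2 => hcd q ⟨h1, h2.trans_lt hzd⟩),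
      le_antisymm (le_sSup fun q h1 h2 => hcd q ⟨hcz.trans_le h1, h2⟩) hd⟩

theorem IsNonIdemInterval.mem_intervals {T : ContinuousTNorm a b} {I : Icc a b × Icc a b}
    (h : T.IsNonIdemInterval I.1 I.2) : I ∈ T.intervals .P ∨ I ∈ T.intervals .L := by
  refine (isomorphic_product_or_lukasiewicz
    (T.restrict I.1 I.2 h.lt.le h.idem_left h.idem_right) h.lt fun q hq => ?_).imp
    (fun h' => ⟨h, h'⟩) (fun h' => ⟨h, h'⟩)
  by_contra! hne
  refine h.not_idem (incl q) ⟨?_, ?_⟩ (Subtype.ext (congrArg Subtype.val hq :))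
  · exact lt_of_le_of_ne (show I.1 ≤ incl q from q.2.1) fun h => hne.1 (congrArg Subtype.val h).symm
  · exact lt_of_le_of_ne (show incl q ≤ I.2 from q.2.2) fun h => hne.2 (congrArg Subtype.val h)

theorem mem_upsilon_iff {T : ContinuousTNorm a b} {I : Icc a b × Icc a b} :
    I ∈ T.upsilon ↔ ∃ i, I ∈ T.intervals i := by
  constructor
  · rintro ((h | h) | h)
    exacts [⟨_, h⟩, ⟨_, h⟩, ⟨_, h⟩]
  · rintro ⟨i, h⟩
    cases i
    exacts [Or.inl (Or.inl h), Or.inl (Or.inr h), Or.inr h]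

theorem mem_upsilon_iff_isNonIdem_or_isMaxIdem {T : ContinuousTNorm a b} {I : Icc a b × Icc a b} :
    I ∈ T.upsilon ↔ T.IsNonIdemInterval I.1 I.2 ∨ T.IsMaxIdemInterval I.1 I.2 := by
  constructor
  · rintro ((⟨h, -⟩ | ⟨h, -⟩) | h)
    exacts [Or.inl h, Or.inl h, Or.inr h]
  · rintro (h | h)
    exacts [Or.inl h.mem_intervals, Or.inr h]

theorem lt_of_mem_upsilon {T : ContinuousTNorm a b} {I : Icc a b × Icc a b}
    (h : I ∈ T.upsilon) : I.1 < I.2 :=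
  (mem_upsilon_iff_isNonIdem_or_isMaxIdem.1 h).elim (fun h => h.lt) (fun h => h.lt)

theorem exists_mem_upsilon (T : ContinuousTNorm a b) {x y : Icc a b} (hxy : x < y) :
    ∃ I ∈ T.upsilon, ∃ z ∈ Ioo x y, z ∈ Ioo I.1 I.2 := by
  by_cases h : ∀ q ∈ Ioo x y, T.Idem q
  · obtain ⟨c, d, hcd, hc, hd⟩ := T.exists_isMaxIdemInterval hxy h
    obtain ⟨z, hz⟩ := exists_between hxy
    exact ⟨(c, d), mem_upsilon_iff_isNonIdem_or_isMaxIdem.2 (Or.inr hcd), z, hz, hc.trans_lt hz.1, hz.2.trans_le hd⟩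
  · push Not at h
    obtain ⟨q, hq, hqi⟩ := h
    obtain ⟨c, d, hcd, hz⟩ := T.exists_isNonIdemInterval hqi
    exact ⟨(c, d), mem_upsilon_iff_isNonIdem_or_isMaxIdem.2 (Or.inl hcd), q, hq, hz⟩

theorem IsNonIdemInterval.eq_of_overlap {T : ContinuousTNorm a b} {c d c' d' : Icc a b}
    (h : T.IsNonIdemInterval c d) (h' : T.IsNonIdemInterval c' d') (h₁ : c < d') (h₂ : c' < d) :
    c = c' ∧ d = d' := by
  refine ⟨?_, ?_⟩
  · rcases lt_trichotomy c c' with hlt | heq | hlt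
    · exact absurd h'.idem_left (h.not_idem _ ⟨hlt, h₂⟩)
    · exact heq
    · exact absurd h.idem_left (h'.not_idem _ ⟨hlt, h₁⟩)
  · rcases lt_trichotomy d d' with hlt | heq | hlt
    · exact absurd h.idem_right (h'.not_idem _ ⟨h₂, hlt⟩)
    · exact heq
    · exact absurd h'.idem_right (h.not_idem _ ⟨h₁, hlt⟩)

theorem IsNonIdemInterval.not_overlap {T : ContinuousTNorm a b} {c d c' d' : Icc a b}
    (h : T.IsNonIdemInterval c d) (h' : T.IsMaxIdemInterval c' d') (h₁ : c < d') :
    d ≤ c' := by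
  by_contra! h₂
  obtain ⟨z, hz, hz'⟩ := exists_between
    (max_lt (lt_min h.lt h₁) (lt_min h₂ h'.lt) : max c c' < min d d')
  rw [max_lt_iff] at hz
  rw [lt_min_iff] at hz'
  exact h.not_idem z ⟨hz.1, hz'.1⟩ (h'.idem z ⟨hz.2, hz'.2⟩)

/-- The union of two overlapping intervals is again an interval of idempotents, so maximality makes
both equal to it. -/
theorem IsMaxIdemInterval.eq_of_overlap {T : ContinuousTNorm a b} {c d c' d' : Icc a b}
    (h : T.IsMaxIdemInterval c d) (h' : T.IsMaxIdemInterval c' d') (h₁ : c < d') (h₂ : c' < d) :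
    c = c' ∧ d = d' := by
  have hunion : ∀ q ∈ Ioo (min c c') (max d d'), T.Idem q := by
    rintro q ⟨hq, hq'⟩
    rw [min_lt_iff] at hq
    rw [lt_max_iff] at hq'
    by_cases hI : q ∈ Ioo c d
    · exact h.idem q hI
    · refine h'.idem q ?_
      rw [mem_Ioo, not_and_or, not_lt, not_lt] at hI
      rcases hI with hI | hI
      · exact ⟨hq.resolve_left (not_lt.2 hI), hI.trans_lt h₁⟩
      · exact ⟨h₂.trans_le hI, hq'.resolve_left (not_lt.2 hI)⟩
  have e := h.maximal _ _ (min_le_left _ _) (le_max_left _ _) hunion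
  have e' := h'.maximal _ _ (min_le_right _ _) (le_max_right _ _) hunion
  exact ⟨e.1.symm.trans e'.1, e.2.symm.trans e'.2⟩

theorem upsilonLT_trichotomy {T : ContinuousTNorm a b} (I J : T.upsilon) :
    T.upsilonLT I J ∨ I = J ∨ T.upsilonLT J I := by
  by_contra! hne
  obtain ⟨h₁, hIJ, h₂⟩ := hne
  simp only [upsilonLT, not_le] at h₁ h₂
  apply hIJ
  rcases mem_upsilon_iff_isNonIdem_or_isMaxIdem.1 I.2 with hI | hI <;> rcases mem_upsilon_iff_isNonIdem_or_isMaxIdem.1 J.2 with hJ | hJ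
  · have := hI.eq_of_overlap hJ h₂ h₁
    exact Subtype.ext (Prod.ext this.1 this.2)
  · exact absurd (hI.not_overlap hJ h₂) (not_le.2 h₁)
  · exact absurd (hJ.not_overlap hI h₁) (not_le.2 h₂)
  · have := hI.eq_of_overlap hJ h₂ h₁
    exact Subtype.ext (Prod.ext this.1 this.2)

/-! ### Invariance of the interval system under isomorphism -/

section Transport

variable {S : ContinuousTNorm a b} {T : ContinuousTNorm a' b'} {φ : Icc a b ≃o Icc a' b'}

theorem idem_map (h : ∀ p q, φ (S.op p q) = T.op (φ p) (φ q)) {q : Icc a b} :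
    T.Idem (φ q) ↔ S.Idem q := by
  rw [Idem, Idem, ← h, φ.apply_eq_iff_eq]

theorem forall_Ioo_map {p : Icc a' b' → Prop} {c d : Icc a b} :
    (∀ q ∈ Ioo (φ c) (φ d), p q) ↔ ∀ q ∈ Ioo c d, p (φ q) := by
  rw [φ.surjective.forall]
  simp only [mem_Ioo, φ.lt_iff_lt]

theorem IsNonIdemInterval.map (h : ∀ p q, φ (S.op p q) = T.op (φ p) (φ q)) {c d : Icc a b}
    (hcd : S.IsNonIdemInterval c d) : T.IsNonIdemInterval (φ c) (φ d) where
  lt := φ.lt_iff_lt.2 hcd.lt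
  idem_left := (idem_map h).2 hcd.idem_left
  idem_right := (idem_map h).2 hcd.idem_right
  not_idem := forall_Ioo_map.2 fun q hq => (idem_map h).not.2 (hcd.not_idem q hq)

theorem IsMaxIdemInterval.map (h : ∀ p q, φ (S.op p q) = T.op (φ p) (φ q)) {c d : Icc a b}
    (hcd : S.IsMaxIdemInterval c d) : T.IsMaxIdemInterval (φ c) (φ d) where
  lt := φ.lt_iff_lt.2 hcd.lt
  idem := forall_Ioo_map.2 fun q hq => (idem_map h).2 (hcd.idem q hq)
  maximal := by
    intro c' d' hc hd hid
    obtain ⟨c', rfl⟩ := φ.surjective c'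
    obtain ⟨d', rfl⟩ := φ.surjective d'
    have := hcd.maximal c' d' (φ.le_iff_le.1 hc) (φ.le_iff_le.1 hd)
      fun q hq => (idem_map h).1 (forall_Ioo_map.1 hid q hq)
    exact ⟨congrArg φ this.1, congrArg φ this.2⟩

theorem isomorphic_restrict (h : ∀ p q, φ (S.op p q) = T.op (φ p) (φ q)) {c d : Icc a b}
    (hcd : c ≤ d) (hc : S.Idem c) (hd : S.Idem d) (hcd' : φ c ≤ φ d) (hc' : T.Idem (φ c))
    (hd' : T.Idem (φ d)) :
    Isomorphic (S.restrict c d hcd hc hd) (T.restrict (φ c) (φ d) hcd' hc' hd') := by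
  let f : Icc (c : ℝ) (d : ℝ) → Icc (φ c : ℝ) (φ d : ℝ) := fun p =>
    ⟨φ (incl p), φ.le_iff_le.2 (show c ≤ incl p from p.2.1),
      φ.le_iff_le.2 (show incl p ≤ d from p.2.2)⟩
  have hf : StrictMono f := fun p q hpq => φ.lt_iff_lt.2 (show incl p < incl q from hpq)
  have hs : Function.Surjective f := fun q => by
    have h1 : c ≤ φ.symm (incl q) := φ.le_symm_apply.2 q.2.1
    have h2 : φ.symm (incl q) ≤ d := φ.symm_apply_le.2 q.2.2
    refine ⟨⟨φ.symm (incl q), h1, h2⟩, Subtype.ext ?_⟩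
    have h := congrArg Subtype.val (φ.apply_symm_apply (incl q))
    exact h
  refine isomorphic_of_orderIso (hf.orderIsoOfSurjective f hs) fun p q => Subtype.ext ?_
  have hpq := congrArg Subtype.val (h (incl p) (incl q))
  exact hpq

theorem mem_intervals_map_of_mem (h : ∀ p q, φ (S.op p q) = T.op (φ p) (φ q))
    {I : Icc a b × Icc a b} {i : IntervalType} (hI : I ∈ S.intervals i) :
    (φ I.1, φ I.2) ∈ T.intervals i := by
  cases i
  · obtain ⟨hn, hiso⟩ := hI
    exact ⟨hn.map h, (isomorphic_restrict h _ _ _ _ _ _).symm.trans hiso⟩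
  · obtain ⟨hn, hiso⟩ := hI
    exact ⟨hn.map h, (isomorphic_restrict h _ _ _ _ _ _).symm.trans hiso⟩
  · exact IsMaxIdemInterval.map h hI

theorem mem_intervals_map (h : ∀ p q, φ (S.op p q) = T.op (φ p) (φ q))
    {I : Icc a b × Icc a b} {i : IntervalType} :
    I ∈ S.intervals i ↔ (φ I.1, φ I.2) ∈ T.intervals i := by
  refine ⟨mem_intervals_map_of_mem h, fun hI => ?_⟩
  simpa using mem_intervals_map_of_mem (symm_op h) hI

theorem Isomorphic.exists_relIso (h : Isomorphic S T) :
    ∃ Φ : S.upsilonLT ≃r T.upsilonLT, ∀ (I : S.upsilon) (i : IntervalType),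
      (I : Icc a b × Icc a b) ∈ S.intervals i ↔ (Φ I : Icc a' b' × Icc a' b') ∈ T.intervals i := by
  obtain ⟨φ, -, hφ⟩ := h
  have hmem : ∀ I, I ∈ S.upsilon ↔ (φ.toEquiv.prodCongr φ.toEquiv) I ∈ T.upsilon := fun I => by
    rw [mem_upsilon_iff, mem_upsilon_iff]
    exact exists_congr fun i => mem_intervals_map hφ
  exact ⟨⟨(φ.toEquiv.prodCongr φ.toEquiv).subtypeEquiv hmem, φ.le_iff_le⟩,
    fun I i => mem_intervals_map hφ⟩

end Transport

/-! ### Gluing isomorphisms of the intervals -/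

section OrdinalSum

variable {S : ContinuousTNorm a b} {T : ContinuousTNorm a' b'}

/-- Multiplicativity is phrased through a third point `r`, so that the products are taken in the
ambient t-norms and not in the restrictions. -/
theorem exists_orderIso_of_isomorphic {c d : Icc a b} {c' d' : Icc a' b'}
    (h : S.IsNonIdemInterval c d) (h' : T.IsNonIdemInterval c' d')
    (hiso : Isomorphic (S.restrict c d h.lt.le h.idem_left h.idem_right)
      (T.restrict c' d' h'.lt.le h'.idem_left h'.idem_right)) :
    ∃ ψ : Icc (c : ℝ) (d : ℝ) ≃o Icc (c' : ℝ) (d' : ℝ), ∀ p q r,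
      S.op (incl p) (incl q) = incl r → T.op (incl (ψ p)) (incl (ψ q)) = incl (ψ r) := by
  obtain ⟨ψ, -, hψ⟩ := hiso
  refine ⟨ψ, fun p q r hr => ?_⟩
  have : (S.restrict c d h.lt.le h.idem_left h.idem_right).op p q = r := by
    have hr' := congrArg Subtype.val hr
    exact Subtype.ext hr'
  rw [← this, hψ]
  rfl

theorem exists_orderIso_of_mem_intervals {I : Icc a b × Icc a b} {J : Icc a' b' × Icc a' b'}
    {i : IntervalType} (hI : I ∈ S.intervals i) (hJ : J ∈ T.intervals i) :
    ∃ ψ : Icc (I.1 : ℝ) (I.2 : ℝ) ≃o Icc (J.1 : ℝ) (J.2 : ℝ),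
      S.IsNonIdemInterval I.1 I.2 → ∀ p q r,
        S.op (incl p) (incl q) = incl r → T.op (incl (ψ p)) (incl (ψ q)) = incl (ψ r) := by
  cases i
  · obtain ⟨h, hiso⟩ := hI
    obtain ⟨h', hiso'⟩ := hJ
    exact (exists_orderIso_of_isomorphic h h' (hiso.trans hiso'.symm)).imp fun ψ hψ _ => hψ
  · obtain ⟨h, hiso⟩ := hI
    obtain ⟨h', hiso'⟩ := hJ
    exact (exists_orderIso_of_isomorphic h h' (hiso.trans hiso'.symm)).imp fun ψ hψ _ => hψ
  · have hI' : S.IsMaxIdemInterval I.1 I.2 := hI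
    have hJ' : T.IsMaxIdemInterval J.1 J.2 := hJ
    obtain ⟨ψ⟩ := exists_orderIso_Icc (show (I.1 : ℝ) < I.2 from hI'.lt)
      (show (J.1 : ℝ) < J.2 from hJ'.lt)
    -- Multiplicativity is claimed only for non-idempotent intervals, so on type M any order
    -- isomorphism serves.
    exact ⟨ψ, fun h => absurd h.lt (not_lt.2 (h.not_overlap hI' h.lt))⟩

theorem isomorphic_of_relIso (Φ : S.upsilonLT ≃r T.upsilonLT)
    (hΦ : ∀ (I : S.upsilon) (i : IntervalType),
      (I : Icc a b × Icc a b) ∈ S.intervals i ↔ (Φ I : Icc a' b' × Icc a' b') ∈ T.intervals i) :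
    Isomorphic S T := by
  have : Fact (a ≤ b) := ⟨S.le⟩
  have : Fact (a' ≤ b') := ⟨T.le⟩
  have hex : ∀ I : S.upsilon, ∃ ψ : Icc (I.1.1 : ℝ) (I.1.2 : ℝ) ≃o
      Icc ((Φ I).1.1 : ℝ) ((Φ I).1.2 : ℝ), S.IsNonIdemInterval I.1.1 I.1.2 → ∀ p q r,
        S.op (incl p) (incl q) = incl r →
          T.op (incl (ψ p)) (incl (ψ q)) = incl (ψ r) := fun I => by
    obtain ⟨i, hi⟩ := mem_upsilon_iff.1 I.2
    exact exists_orderIso_of_mem_intervals hi ((hΦ I i).1 hi)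
  choose ψ hψ using hex
  have hlt : ∀ (I : S.upsilon) (p : Icc (I.1.1 : ℝ) (I.1.2 : ℝ)),
      incl p < I.1.2 ↔ incl (ψ I p) < (Φ I).1.2 := fun I p => by
    have hI : (I.1.1 : ℝ) ≤ I.1.2 := (lt_of_mem_upsilon I.2).le
    have hJ : ((Φ I).1.1 : ℝ) ≤ (Φ I).1.2 := (lt_of_mem_upsilon (Φ I).2).le
    have htop : ψ I ⟨I.1.2, hI, le_rfl⟩ = ⟨(Φ I).1.2, hJ, le_rfl⟩ := by
      refine le_antisymm (ψ I _).2.2 ?_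
      rw [← (ψ I).symm_apply_le]
      exact ((ψ I).symm _).2.2
    exact ((ψ I).lt_iff_lt (x := p) (y := ⟨I.1.2, hI, le_rfl⟩)).symm.trans
      (iff_of_eq (congrArg (ψ I p < ·) htop))
  have hgt : ∀ (I : S.upsilon) (p : Icc (I.1.1 : ℝ) (I.1.2 : ℝ)),
      (Φ I).1.1 < incl (ψ I p) → I.1.1 < incl p := fun I p h => by
    have hI : (I.1.1 : ℝ) ≤ I.1.2 := (lt_of_mem_upsilon I.2).le
    refine (ψ I).lt_iff_lt (x := ⟨I.1.1, le_rfl, hI⟩) (y := p) |>.1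
      (lt_of_le_of_lt ?_ (show (⟨(Φ I).1.1, le_rfl, (lt_of_mem_upsilon (Φ I).2).le⟩ :
        Icc ((Φ I).1.1 : ℝ) ((Φ I).1.2 : ℝ)) < ψ I p from h))
    rw [← (ψ I).le_symm_apply]
    exact ((ψ I).symm ⟨_, le_rfl, (lt_of_mem_upsilon (Φ I).2).le⟩).2.1
  -- Half-open intervals: dropping right ends avoids conflicts where adjacent intervals meet, while
  -- left ends are kept because a product inside `(c, d)` may equal `c`.
  let R : Icc a b → Icc a' b' → Prop := fun x y => ∃ (I : S.upsilon)
    (p : Icc (I.1.1 : ℝ) (I.1.2 : ℝ)), incl p < I.1.2 ∧ incl p = x ∧ incl (ψ I p) = y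
  obtain ⟨φ, hφ⟩ : ∃ φ : Icc a b ≃o Icc a' b', ∀ x y, R x y → φ x = y := by
    refine exists_orderIso_of_dense_relation R ?_ ?_ ?_
    · rintro _ _ _ _ ⟨I, p, hp, rfl, rfl⟩ ⟨J, q, hq, rfl, rfl⟩
      have key : ∀ (I J : S.upsilon) (p : Icc (I.1.1 : ℝ) (I.1.2 : ℝ))
          (q : Icc (J.1.1 : ℝ) (J.1.2 : ℝ)), incl p < I.1.2 → S.upsilonLT I J →
            incl p < incl q ∧ incl (ψ I p) < incl (ψ J q) := fun I J p q hp h =>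
        ⟨hp.trans_le (le_trans (show I.1.2 ≤ J.1.1 from h) q.2.1),
          ((hlt I p).1 hp).trans_le (le_trans (show (Φ I).1.2 ≤ (Φ J).1.1 from
            Φ.map_rel_iff.2 h) (ψ J q).2.1)⟩
      rcases upsilonLT_trichotomy I J with h | rfl | h
      · have := key I J p q hp h
        exact iff_of_true this.1 this.2
      · exact ((ψ I).lt_iff_lt (x := p) (y := q)).symm
      · have := key J I q p hq h
        exact iff_of_false this.1.not_gt this.2.not_gt
    · intro x x' hxx'
      obtain ⟨I, hI, z, hz, hzI⟩ := S.exists_mem_upsilon hxx'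
      exact ⟨z, _, hz.1, hz.2, ⟨I, hI⟩, ⟨z, hzI.1.le, hzI.2.le⟩, hzI.2, rfl, rfl⟩
    · intro y y' hyy'
      obtain ⟨J, hJ, z, hz, hzJ⟩ := T.exists_mem_upsilon hyy'
      obtain ⟨I, hI⟩ := Φ.surjective ⟨J, hJ⟩
      obtain rfl : (Φ I).1 = J := congrArg Subtype.val hI
      have hψz : ψ I ((ψ I).symm ⟨z, hzJ.1.le, hzJ.2.le⟩) = ⟨z, hzJ.1.le, hzJ.2.le⟩ :=
        (ψ I).apply_symm_apply _
      refine ⟨_, z, hz.1, hz.2, I, (ψ I).symm ⟨z, hzJ.1.le, hzJ.2.le⟩, ?_, rfl, ?_⟩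
      · rw [hlt, hψz]; exact hzJ.2
      · rw [hψz]; rfl
  -- A non-idempotent `φ e` would lie inside some `Φ I` of type P or Ł, placing `e` inside `I`,
  -- which has the same type and hence no interior idempotents.
  have hidem : ∀ e, S.Idem e → T.Idem (φ e) := fun e he => by
    by_contra hne
    obtain ⟨c, d, hcd, hz⟩ := T.exists_isNonIdemInterval hne
    obtain ⟨I, hI⟩ := Φ.surjective ⟨(c, d), mem_upsilon_iff_isNonIdem_or_isMaxIdem.2 (Or.inl hcd)⟩
    obtain ⟨rfl, rfl⟩ : (Φ I).1.1 = c ∧ (Φ I).1.2 = d := by rw [hI]; exact ⟨rfl, rfl⟩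
    obtain ⟨p, hp⟩ := (ψ I).surjective ⟨φ e, hz.1.le, hz.2.le⟩
    have hpe : incl (ψ I p) = φ e := by rw [hp]; rfl
    have hp2 : incl p < I.1.2 := (hlt I p).2 (hpe ▸ hz.2)
    have hp1 : I.1.1 < incl p := hgt I p (hpe ▸ hz.1)
    obtain rfl : incl p = e := φ.injective ((hφ _ _ ⟨I, p, hp2, rfl, rfl⟩).trans hpe)
    have hnon : S.IsNonIdemInterval I.1.1 I.1.2 := by
      rcases hcd.mem_intervals (I := (Φ I).1) with h | h
      · exact ((hΦ I .P).2 h).1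
      · exact ((hΦ I .L).2 h).1
    exact hnon.not_idem _ ⟨hp1, hp2⟩ he
  have hle : ∀ x y, x ≤ y → φ (S.op x y) = T.op (φ x) (φ y) := fun x y hxy => by
    -- With a separating idempotent both products are minima; without one, `x` and `y` share a
    -- component and `ψ` applies.
    by_cases h : ∃ e, S.Idem e ∧ x ≤ e ∧ e ≤ y
    · obtain ⟨e, he, hxe, hey⟩ := h
      rw [S.op_eq_left_of_idem he hxe hey,
        T.op_eq_left_of_idem (hidem e he) (φ.le_iff_le.2 hxe) (φ.le_iff_le.2 hey)]
    · obtain ⟨c, d, hcd, hx⟩ := S.exists_isNonIdemInterval fun hx => h ⟨x, hx, le_rfl, hxy⟩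
      have hyd : y < d := lt_of_not_ge fun hy => h ⟨d, hcd.idem_right, hx.2.le, hy⟩
      let I : S.upsilon := ⟨(c, d), mem_upsilon_iff_isNonIdem_or_isMaxIdem.2 (Or.inl hcd)⟩
      have hxy_lt : S.op x y < d := (S.op_le_left x y).trans_lt hx.2
      have hc_le : c ≤ S.op x y := by
        calc c = S.op c c := hcd.idem_left.symm
          _ ≤ S.op x y := S.op_mono _ _ _ _ hx.1.le (hx.1.le.trans hxy)
      have hval : ∀ z (hz : c ≤ z) (hz' : z < d), φ z = incl (ψ I ⟨z, hz, hz'.le⟩) :=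
        fun z hz hz' => hφ _ _ ⟨I, ⟨z, hz, hz'.le⟩, hz', rfl, rfl⟩
      rw [hval _ hc_le hxy_lt, hval x hx.1.le hx.2, hval y (hx.1.le.trans hxy) hyd]
      exact (hψ I hcd _ _ _ rfl).symm
  refine isomorphic_of_orderIso φ fun x y => ?_
  rcases le_total x y with h | h
  · exact hle x y h
  · rw [S.op_comm, T.op_comm, hle y x h]

end OrdinalSum

end ContinuousTNorm

theorem theorem2p4 (S T : ContinuousTNorm 0 1) :
    ContinuousTNorm.Isomorphic S T ↔
      ∃ Φ : S.upsilonLT ≃r T.upsilonLT,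
        ∀ (I : S.upsilon) (i : ContinuousTNorm.IntervalType),
          (I : Icc (0 : ℝ) 1 × Icc (0 : ℝ) 1) ∈ S.intervals i ↔
            (Φ I : Icc (0 : ℝ) 1 × Icc (0 : ℝ) 1) ∈ T.intervals i :=
  ⟨fun h => h.exists_relIso, fun ⟨Φ, hΦ⟩ => ContinuousTNorm.isomorphic_of_relIso Φ hΦ⟩
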